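/- Conventions. Let $d\in\mathbb N$. For $z=(x,\omega)\in\mathbb R^{2d}$ let $\pi(z)g(t)=e^{2\pi i\omega\cdot t}g(t-x)$ on $L^2(\mathbb R^d)$, and $\alpha_z(S)=\pi(z)S\pi(z)^*$ for $S\in\mathcal B(L^2(\mathbb R^d))$. Let $Pf(t)=f(-t)$, let $f\otimes g$ be the rank-one operator $h\mapsto\langle h,g\rangle f$, and put $A\star B(z)=\mathrm{tr}(A\,\alpha_z(PBP))$. The polarized Cohen's class of $S$ is $$Q_S(f,g)(z)=\big((f\otimes g)\star(PSP)\big)(z)=\langle\alpha_z(S)f,g\rangle .$$ A bounded operator is trace class if it is compact with summable singular values. On $\mathbb R^{2d}$ let $V_\Phi F(y,\zeta)=\int F(t)\overline{\Phi(t-y)}e^{-2\pi i\zeta\cdot t}\,dt$, also for tempered distributions $F$ and Schwartz windows $\Phi$, and let $\varphi_0(z)=2^{d/2}e^{-\pi|z|^2}$. The space $S_0'(\mathbb R^{2d})$ is the dual of Feichtinger's algebra $S_0(\mathbb R^{2d})=\{f: V_{\varphi_0}f\in L^1\}$. The Fernández–Galbis class $FG(\mathbb R^{2d})$ consists of the $F\in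 S_0'(\mathbb R^{2d})$ for which there is a nonzero $\Phi\in\mathcal S(\mathbb R^{2d})$ with $\lim_{|y|\to\infty}\sup_{|\zeta|<R}|V_\Phi F(y,\zeta)|=0$ for every $R>0$. For $F\in S_0'(\mathbb R^{2d})$ and a function $H$, the integral of $FH$ is understood distributionally, $$\int_{\mathbb R^{2d}}F(z)H(z)\,dz:=\int_{\mathbb R^{2d}}\Big(\int_{\mathbb R^{2d}}V_{\varphi_0}F(y,\zeta)\,\overline{V_{\varphi_0}\overline H(y,\zeta)}\,d\zeta\Big)dy,$$ and it converges if the inner integrals and the outer one converge absolutely. Proposition (quantum double orthogonality). Let $S$ be a trace class operator on $L^2(\mathbb R^d)$ and $F\in FG(\mathbb R^{2d})$, and assume that the weak integral defining $F\star S=\int F(z)\alpha_z(S)\,dz$ converges on $L^2(\mathbb R^d)$, i.e. that $\int F(z)\langle\alpha_z(S)f,g\rangle\,dz$ converges for all $f,g\in L^2(\mathbb R^d)$ (this is automatic if $F\in L^1(\mathbb R^{2d})+L^\infty(\mathbb R^{2d})$). Let $F\star S$ be the bounded operator with $\langle(F\star S)f,g\rangle=\int F(z)\langle\alpha_z(S)f,g\rangle\,dz$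 for all $f,g\in L^2(\mathbb R^d)$. Let $\{\psi_n\}_{n\in\mathbb N_0^d}$ be a family in $L^2(\mathbb R^d)$. Then $\{\psi_n\}$ is an eigenbasis of $F\star S$ (an orthonormal basis of $L^2(\mathbb R^d)$ consisting of eigenfunctions of $F\star S$) if and only if $$\{\psi_n\}_{n\in\mathbb N_0^d}\text{ is an orthonormal basis of }L^2(\mathbb R^d)$$ and there are constants $c_n\in\mathbb C$ such that $$\int_{\mathbb R^{2d}}F(z)\,Q_S(\psi_n,\psi_m)(z)\,dz=c_n\delta_{n,m}\qquad\text{for all }n,m\in\mathbb N_0^d .$$ In this case $\psi_n$ is an eigenfunction of $F\star S$ with eigenvalue $c_n$, for every $n$. Moreover, if $F\star S$ is compact and normal, then the two conditions are also equivalent to $\{\psi_n\}$ being a full orthonormal system of eigenfunctions of $F\star S$, i.e. an orthonormal family of eigenfunctions such that no eigenfunction is orthogonal to all $\psi_n$. -/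

import Mathlib

open MeasureTheory Filter Topology
open scoped SchwartzMap ENNReal ComplexConjugate

noncomputable section

namespace QHA

/-- Configuration space `ℝ^d`. -/
abbrev Pos (d : ℕ) : Type := EuclideanSpace ℝ (Fin d)

/-- The time-frequency plane `ℝ^{2d}`, with points `z = (x, ω)`. -/
abbrev Phase (d : ℕ) : Type := Pos d × Pos d

/-- `L²(ℝ^d)`. -/
abbrev L2 (d : ℕ) : Type := Lp ℂ 2 (volume : Measure (Pos d))

variable {d : ℕ}

/-! ### Time-frequency shifts and shifted operators -/

/-- The character `e^{2πi r}`. -/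
def char (r : ℝ) : ℂ := Complex.exp (2 * Real.pi * Complex.I * r)

theorem norm_char (r : ℝ) : ‖char r‖ = 1 := by
  have h : (2 * Real.pi * Complex.I * r : ℂ) = ((2 * Real.pi * r : ℝ) : ℂ) * Complex.I := by
    push_cast; ring
  rw [char, h, Complex.norm_exp_ofReal_mul_I]

theorem continuous_char : Continuous char := by
  unfold char; fun_prop

theorem memLp_modulation (ω : Pos d) (g : L2 d) :
    MemLp (fun t => char (inner ℝ ω t) * g t) 2 (volume : Measure (Pos d)) := by
  have hc : Continuous fun t : Pos d => char (inner ℝ ω t) :=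
    continuous_char.comp (by fun_prop)
  refine (Lp.memLp g).of_le (hc.aestronglyMeasurable.mul (Lp.aestronglyMeasurable g)) ?_
  exact Eventually.of_forall fun t => by simp [norm_char]

/-- Modulation `(M_ω g)(t) = e^{2πi ω·t} g(t)`. -/
def modulation (ω : Pos d) : L2 d →ₗᵢ[ℂ] L2 d where
  toFun g := (memLp_modulation ω g).toLp
  map_add' f g := by
    apply Lp.ext
    filter_upwards [(memLp_modulation ω (f + g)).coeFn_toLp, (memLp_modulation ω f).coeFn_toLp,
      (memLp_modulation ω g).coeFn_toLp, Lp.coeFn_add f g,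
      Lp.coeFn_add (memLp_modulation ω f).toLp (memLp_modulation ω g).toLp] with t h1 h2 h3 h4 h5
    rw [h1, h5, Pi.add_apply, h2, h3, h4, Pi.add_apply, mul_add]
  map_smul' c g := by
    apply Lp.ext
    filter_upwards [(memLp_modulation ω (c • g)).coeFn_toLp, (memLp_modulation ω g).coeFn_toLp,
      Lp.coeFn_smul c g, Lp.coeFn_smul c (memLp_modulation ω g).toLp] with t h1 h2 h3 h4
    simp only [RingHom.id_apply]
    rw [h1, h4, Pi.smul_apply, h2, h3, Pi.smul_apply, smul_eq_mul, smul_eq_mul]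
    ring
  norm_map' g := by
    refine le_antisymm (Lp.norm_le_norm_of_ae_le ?_) (Lp.norm_le_norm_of_ae_le ?_) <;>
    · filter_upwards [(memLp_modulation ω g).coeFn_toLp] with t h1
      simp only [LinearMap.coe_mk, AddHom.coe_mk]
      rw [h1, norm_mul, norm_char, one_mul]

/-- Translation `(T_x g)(t) = g(t - x)`. -/
def translation (x : Pos d) : L2 d →ₗᵢ[ℂ] L2 d :=
  Lp.compMeasurePreservingₗᵢ ℂ (fun t => t - x) (measurePreserving_sub_right volume x)

/-- The time-frequency shift `(π(x,ω) g)(t) = e^{2πi ω·t} g(t - x)`. -/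
def tfShift (z : Phase d) : L2 d →L[ℂ] L2 d :=
  ((modulation z.2).comp (translation z.1)).toContinuousLinearMap

/-- The operator shift `α_z(S) = π(z) S π(z)^*`. -/
def opShift (z : Phase d) (S : L2 d →L[ℂ] L2 d) : L2 d →L[ℂ] L2 d :=
  tfShift z ∘L S ∘L ContinuousLinearMap.adjoint (tfShift z)

/-- The parity operator `(P g)(t) = g(-t)`. -/
def parity : L2 d →L[ℂ] L2 d :=
  (Lp.compMeasurePreservingₗᵢ ℂ (fun t : Pos d => -t)
    (Measure.measurePreserving_neg volume)).toContinuousLinearMap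

/-- The reflected operator `P S P`. -/
def reflect (S : L2 d →L[ℂ] L2 d) : L2 d →L[ℂ] L2 d := parity ∘L S ∘L parity

theorem parity_parity (g : L2 d) : parity (parity g) = g := by
  have hm := Measure.measurePreserving_neg (volume : Measure (Pos d))
  apply Lp.ext
  have h1 : (parity (parity g) : L2 d) =ᵐ[volume] (parity g : L2 d) ∘ fun t : Pos d => -t :=
    Lp.coeFn_compMeasurePreserving (parity g) hm
  have h2 : (parity g : L2 d) =ᵐ[volume] g ∘ fun t : Pos d => -t :=
    Lp.coeFn_compMeasurePreserving g hm
  have h3 := hm.quasiMeasurePreserving.ae_eq_comp h2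
  filter_upwards [h1, h3] with t h1 h3
  rw [h1, h3]
  simp

theorem reflect_reflect (S : L2 d →L[ℂ] L2 d) : reflect (reflect S) = S := by
  ext1 g
  simp [reflect, parity_parity]

/-! ### Trace class operators, the trace, operator convolution and Cohen's class -/

/-- `S` is trace class: `S = ∑ σ_k u_k ⊗ v_k` in operator norm, with (finite or countable)
orthonormal systems `u`, `v` and summable singular values `σ_k ≥ 0`.
Here `u ⊗ v` is the rank-one operator `h ↦ ⟨h, v⟩ u`. -/
def IsTraceClass (S : L2 d →L[ℂ] L2 d) : Prop :=
  ∃ (I : Set ℕ) (σ : I → ℝ) (u v : I → L2 d),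
    Orthonormal ℂ u ∧ Orthonormal ℂ v ∧ (∀ k, 0 ≤ σ k) ∧ Summable σ ∧
      HasSum (fun k => (σ k : ℂ) • InnerProductSpace.rankOne ℂ (u k) (v k)) S

/-- The trace `∑ ⟨A e_i, e_i⟩` over an orthonormal basis `e` of `L²(ℝ^d)`
(for trace class `A` it does not depend on `e`). -/
def trace (A : L2 d →L[ℂ] L2 d) : ℂ :=
  ∑' i, inner ℂ ((exists_hilbertBasis ℂ (L2 d)).choose_spec.choose i)
    (A ((exists_hilbertBasis ℂ (L2 d)).choose_spec.choose i))

/-- The convolution of two operators, `(A ⋆ B)(z) = tr(A α_z(P B P))`. -/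
def opConv (A B : L2 d →L[ℂ] L2 d) (z : Phase d) : ℂ :=
  trace (A ∘L opShift z (reflect B))

/-- The polarized Cohen's class `Q_S(f, g) = (f ⊗ g) ⋆ (P S P)` of the operator `S`. -/
def polarizedCohen (S : L2 d →L[ℂ] L2 d) (f g : L2 d) : Phase d → ℂ :=
  opConv (InnerProductSpace.rankOne ℂ f g) (reflect S)

/-- `Q_S(f, g)(z) = ⟨α_z(S) f, g⟩`. -/
theorem polarizedCohen_apply (S : L2 d →L[ℂ] L2 d) (f g : L2 d) (z : Phase d) :
    polarizedCohen S f g z = inner ℂ g (opShift z S f) := by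
  rw [polarizedCohen, opConv, reflect_reflect, trace]
  set b := (exists_hilbertBasis ℂ (L2 d)).choose_spec.choose with hb
  rw [← ContinuousLinearMap.adjoint_inner_left,
    ← b.tsum_inner_mul_inner (ContinuousLinearMap.adjoint (opShift z S) g) f]
  refine tsum_congr fun i => ?_
  rw [ContinuousLinearMap.comp_apply, InnerProductSpace.rankOne_apply, inner_smul_right,
    ContinuousLinearMap.adjoint_inner_left]

/-! ### The short-time Fourier transform on `ℝ^{2d}` and mild distributions -/

/-- The Euclidean inner product on `ℝ^{2d}`. -/
def phaseInner (ζ t : Phase d) : ℝ := inner ℝ ζ.1 t.1 + inner ℝ ζ.2 t.2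

theorem contDiff_cexp_mul (c : ℂ) :
    ContDiff ℝ (⊤ : ℕ∞) fun r : ℝ => Complex.exp (c * r) :=
  (contDiff_const.mul Complex.ofRealCLM.contDiff).cexp

theorem iteratedDeriv_cexp_mul (c : ℂ) (n : ℕ) :
    iteratedDeriv n (fun r : ℝ => Complex.exp (c * r)) =
      fun r : ℝ => c ^ n * Complex.exp (c * r) := by
  induction n with
  | zero => simp
  | succ n ih =>
    rw [iteratedDeriv_succ, ih]
    funext r
    have h : HasDerivAt (fun r : ℝ => Complex.exp (c * r)) (Complex.exp (c * r) * (c * 1)) r :=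
      (((Complex.ofRealCLM.hasDerivAt (x := r)).const_mul c)).cexp
    rw [(h.const_mul (c ^ n)).deriv]
    ring

theorem hasTemperateGrowth_char : Function.HasTemperateGrowth char := by
  have hchar : char = fun r : ℝ => Complex.exp ((2 * Real.pi * Complex.I) * r) := rfl
  refine ⟨hchar ▸ contDiff_cexp_mul _, fun n =>
    ⟨0, ‖(2 * Real.pi * Complex.I : ℂ)‖ ^ n, fun r => ?_⟩⟩
  rw [norm_iteratedFDeriv_eq_norm_iteratedDeriv, hchar, iteratedDeriv_cexp_mul, norm_mul, norm_pow]
  have := norm_char r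
  rw [hchar] at this
  rw [this]
  simp

theorem hasTemperateGrowth_phaseInner (ζ : Phase d) :
    Function.HasTemperateGrowth (phaseInner ζ) :=
  (((innerSL ℝ ζ.1) ∘L ContinuousLinearMap.fst ℝ (Pos d) (Pos d)) +
    ((innerSL ℝ ζ.2) ∘L ContinuousLinearMap.snd ℝ (Pos d) (Pos d))).hasTemperateGrowth

theorem hasTemperateGrowth_char_phaseInner (ζ : Phase d) :
    Function.HasTemperateGrowth fun t : Phase d => char (-phaseInner ζ t) :=
  hasTemperateGrowth_char.comp (hasTemperateGrowth_phaseInner ζ).neg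

/-- The Schwartz function `t ↦ e^{-2πi ζ·t} conj(Φ(t - y))`, the conjugate of the
time-frequency shift of `Φ` by `(y, ζ)`. -/
def conjShift (Φ : 𝓢(Phase d, ℂ)) (y ζ : Phase d) : 𝓢(Phase d, ℂ) :=
  SchwartzMap.smulLeftCLM ℂ (fun t : Phase d => char (-phaseInner ζ t))
    (SchwartzMap.compSubConstCLM ℂ y
      (SchwartzMap.postcompCLM (Complex.conjCLE : ℂ →L[ℝ] ℂ) Φ))

theorem conjShift_apply (Φ : 𝓢(Phase d, ℂ)) (y ζ t : Phase d) :
    conjShift Φ y ζ t = char (-phaseInner ζ t) * conj (Φ (t - y)) := by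
  rw [conjShift, SchwartzMap.smulLeftCLM_apply_apply (hasTemperateGrowth_char_phaseInner ζ)]
  simp

/-- The short-time Fourier transform `V_Φ F(y, ζ)` of a tempered distribution `F` on `ℝ^{2d}`. -/
def distSTFT (Φ : 𝓢(Phase d, ℂ)) (F : 𝓢'(Phase d, ℂ)) (y ζ : Phase d) : ℂ :=
  F (conjShift Φ y ζ)

/-- The short-time Fourier transform
`V_Φ H(y, ζ) = ∫ H(t) conj(Φ(t - y)) e^{-2πi ζ·t} dt` of a function `H` on `ℝ^{2d}`. -/
def funSTFT (Φ H : Phase d → ℂ) (y ζ : Phase d) : ℂ :=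
  ∫ t, H t * conj (Φ (t - y)) * char (-phaseInner ζ t)

/-- `-π |z|²`, with the Euclidean norm of `ℝ^{2d}`. -/
def gaussExponent (z : Phase d) : ℝ := -Real.pi * (‖z.1‖ ^ 2 + ‖z.2‖ ^ 2)

theorem hasTemperateGrowth_gaussExponent :
    Function.HasTemperateGrowth (gaussExponent : Phase d → ℝ) := by
  have h (L : Phase d →L[ℝ] Pos d) : Function.HasTemperateGrowth fun z : Phase d => ‖L z‖ ^ 2 := by
    have := (innerSL ℝ (E := Pos d)).bilinear_hasTemperateGrowth
      L.hasTemperateGrowth L.hasTemperateGrowth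
    have h2 : (fun z : Phase d => ‖L z‖ ^ 2) = fun z => innerSL ℝ (L z) (L z) := by
      funext z
      exact (real_inner_self_eq_norm_sq (L z)).symm
    rw [h2]
    exact this
  exact (Function.HasTemperateGrowth.const (-Real.pi)).mul
    ((h (ContinuousLinearMap.fst ℝ _ _)).add (h (ContinuousLinearMap.snd ℝ _ _)))

theorem exp_gaussExponent_le (z : Phase d) (m : ℕ) :
    (1 + ‖z‖) ^ m * Real.exp (gaussExponent z) ≤ m.factorial * Real.exp 2 := by
  have h1 : (1 + ‖z‖) ^ m ≤ m.factorial * Real.exp (1 + ‖z‖) := by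
    have := Real.pow_div_factorial_le_exp (1 + ‖z‖) (by positivity) m
    rwa [div_le_iff₀ (by positivity), mul_comm] at this
  have h2 : ‖z‖ ^ 2 ≤ ‖z.1‖ ^ 2 + ‖z.2‖ ^ 2 := by
    rcases le_total ‖z.1‖ ‖z.2‖ with h | h
    · rw [Prod.norm_def, max_eq_right h]; nlinarith [sq_nonneg ‖z.1‖]
    · rw [Prod.norm_def, max_eq_left h]; nlinarith [sq_nonneg ‖z.2‖]
  have h3 : 1 + ‖z‖ + gaussExponent z ≤ 2 := by
    unfold gaussExponent
    have h5 : Real.pi * ‖z‖ ^ 2 ≤ Real.pi * (‖z.1‖ ^ 2 + ‖z.2‖ ^ 2) :=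
      mul_le_mul_of_nonneg_left h2 Real.pi_pos.le
    nlinarith [Real.pi_gt_three, sq_nonneg (‖z‖ - 1), sq_nonneg ‖z‖]
  calc (1 + ‖z‖) ^ m * Real.exp (gaussExponent z)
      ≤ m.factorial * Real.exp (1 + ‖z‖) * Real.exp (gaussExponent z) := by gcongr
    _ = m.factorial * Real.exp (1 + ‖z‖ + gaussExponent z) := by
        rw [Real.exp_add (1 + ‖z‖) (gaussExponent z)]; ring
    _ ≤ m.factorial * Real.exp 2 := by gcongr

/-- The function `e^{-π|z|²}` as a Schwartz function on `ℝ^{2d}`. -/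
def rawGaussian (d : ℕ) : 𝓢(Phase d, ℂ) where
  toFun z := Complex.exp (gaussExponent z)
  smooth' :=
    (Complex.contDiff_exp (𝕜 := ℝ)).comp
      (Complex.ofRealCLM.contDiff.comp hasTemperateGrowth_gaussExponent.1)
  decay' k n := by
    obtain ⟨l, C, hC, hb⟩ :=
      (hasTemperateGrowth_gaussExponent (d := d)).norm_iteratedFDeriv_le_uniform n
    have hcomp : (fun z : Phase d => Complex.exp (gaussExponent z)) =
        (fun r : ℝ => Complex.exp ((1 : ℂ) * r)) ∘ gaussExponent := by
      funext z; simp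
    refine ⟨n.factorial * (1 + C) ^ n * ((k + l * n).factorial * Real.exp 2), fun z => ?_⟩
    have key := norm_iteratedFDeriv_comp_le (n := n) (N := ((⊤ : ℕ∞) : WithTop ℕ∞))
      (contDiff_cexp_mul 1) (hasTemperateGrowth_gaussExponent (d := d)).1
      (mod_cast le_top) z (C := Real.exp (gaussExponent z)) (D := (1 + C) * (1 + ‖z‖) ^ l)
      (fun i _ => by
        rw [norm_iteratedFDeriv_eq_norm_iteratedDeriv, iteratedDeriv_cexp_mul]
        simp [Complex.norm_exp])
      (fun i hi hin => by
        have h1 : (1 : ℝ) ≤ (1 + C) * (1 + ‖z‖) ^ l :=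
          one_le_mul_of_one_le_of_one_le (by linarith)
            (one_le_pow₀ (by linarith [norm_nonneg z]))
        calc _ ≤ C * (1 + ‖z‖) ^ l := hb i hin z
          _ ≤ (1 + C) * (1 + ‖z‖) ^ l := by gcongr; linarith
          _ ≤ _ := le_self_pow₀ h1 (by omega))
    rw [hcomp]
    calc ‖z‖ ^ k * ‖iteratedFDeriv ℝ n ((fun r : ℝ => Complex.exp ((1 : ℂ) * r)) ∘
            gaussExponent) z‖
        ≤ (1 + ‖z‖) ^ k * (n.factorial * Real.exp (gaussExponent z) *
            ((1 + C) * (1 + ‖z‖) ^ l) ^ n) := by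
          gcongr
          linarith
      _ = n.factorial * (1 + C) ^ n *
            ((1 + ‖z‖) ^ (k + l * n) * Real.exp (gaussExponent z)) := by
          rw [mul_pow, ← pow_mul, pow_add]; ring
      _ ≤ _ := by
          refine mul_le_mul_of_nonneg_left ?_ (by positivity)
          exact exp_gaussExponent_le z _

/-- The `L²`-normalized Gaussian `φ₀(z) = 2^{d/2} e^{-π|z|²}` on `ℝ^{2d}`. -/
def gaussian (d : ℕ) : 𝓢(Phase d, ℂ) := ((2 : ℝ) ^ ((d : ℝ) / 2) : ℝ) • rawGaussian d

/-- `F ∈ S₀'(ℝ^{2d})`: the functional `F` is bounded for the norm `‖V_{φ₀} f‖_{L¹}` of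
Feichtinger's algebra `S₀(ℝ^{2d})`, in which the Schwartz functions are dense. -/
def IsMild (F : 𝓢'(Phase d, ℂ)) : Prop :=
  ∃ C : ℝ, ∀ f : 𝓢(Phase d, ℂ),
    ‖F f‖ ≤ C * ∫ w : Phase d × Phase d, ‖funSTFT (gaussian d) f w.1 w.2‖

/-- The Fernández–Galbis class `FG(ℝ^{2d})`: mild distributions `F` such that for some nonzero
Schwartz window `Φ` and all `R > 0`, `sup_{|ζ| < R} |V_Φ F(y, ζ)| → 0` as `|y| → ∞`. -/
def fernandezGalbis (d : ℕ) : Set 𝓢'(Phase d, ℂ) :=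
  {F | IsMild F ∧ ∃ Φ : 𝓢(Phase d, ℂ), Φ ≠ 0 ∧ ∀ R : ℝ, 0 < R →
    Tendsto (fun y => ⨆ (ζ : Phase d) (_ : ‖ζ‖ < R), ‖distSTFT Φ F y ζ‖ₑ)
      (cocompact (Phase d)) (𝓝 0)}

/-! ### The distributional integral and mixed-state localization operators -/

/-- The integrand `V_{φ₀} F(y, ζ) · conj (V_{φ₀} (conj H) (y, ζ))` of the duality pairing of a
mild distribution `F` with a function `H`. -/
def pairingIntegrand (F : 𝓢'(Phase d, ℂ)) (H : Phase d → ℂ) (y ζ : Phase d) : ℂ :=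
  distSTFT (gaussian d) F y ζ * conj (funSTFT (gaussian d) (fun z => conj (H z)) y ζ)

/-- The distributional integral `∫ F(z) H(z) dz`, that is
`∫ (∫ V_{φ₀} F(y, ζ) conj (V_{φ₀} (conj H) (y, ζ)) dζ) dy`.
When `F` is a function, the inner integral is `∫ F(z) H(z) |φ₀(z - y)|² dz`, and
`∫ |φ₀(z - y)|² dy = 1`. -/
def distIntegral (F : 𝓢'(Phase d, ℂ)) (H : Phase d → ℂ) : ℂ :=
  ∫ y, ∫ ζ, pairingIntegrand F H y ζ

/-- Convergence of the iterated integral `∫ F(z) H(z) dz`. -/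
def DistIntegrable (F : 𝓢'(Phase d, ℂ)) (H : Phase d → ℂ) : Prop :=
  (∀ y, Integrable (pairingIntegrand F H y)) ∧
    Integrable fun y => ∫ ζ, pairingIntegrand F H y ζ

/-- The weak integral `∫ F(z) α_z(S) dz` converges on `L²(ℝ^d)`. -/
def WeaklyConvergent (F : 𝓢'(Phase d, ℂ)) (S : L2 d →L[ℂ] L2 d) : Prop :=
  ∀ f g : L2 d, DistIntegrable F fun z => inner ℂ g (opShift z S f)

open Classical in
/-- The mixed-state localization operator `F ⋆ S = ∫ F(z) α_z(S) dz`, in the weak sense: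
the bounded operator `T` with `⟨T f, g⟩ = ∫ F(z) ⟨α_z(S) f, g⟩ dz` for all `f`, `g`
(and `0` if there is none). -/
def mixedLocOp (F : 𝓢'(Phase d, ℂ)) (S : L2 d →L[ℂ] L2 d) : L2 d →L[ℂ] L2 d :=
  if h : ∃ T : L2 d →L[ℂ] L2 d, ∀ f g : L2 d,
      inner ℂ g (T f) = distIntegral F fun z => inner ℂ g (opShift z S f)
  then h.choose else 0

/-! ### Eigenbases and quantum double orthogonality -/

/-- `ψ` is an orthonormal basis of `L²(ℝ^d)`. -/
def IsONB {ι : Type} (ψ : ι → L2 d) : Prop :=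
  Orthonormal ℂ ψ ∧ (Submodule.span ℂ (Set.range ψ)).topologicalClosure = ⊤

/-- `ψ` is an eigenbasis of `T`: an orthonormal basis that consists of eigenfunctions. -/
def IsEigenbasis {ι : Type} (T : L2 d →L[ℂ] L2 d) (ψ : ι → L2 d) : Prop :=
  IsONB ψ ∧ ∀ n, ∃ μ : ℂ, Module.End.HasEigenvector (T : Module.End ℂ (L2 d)) μ (ψ n)

/-- `ψ` is a full orthonormal system of eigenfunctions of `T`: no eigenfunction of `T` is
orthogonal to all of them. -/
def IsFullEigensystem {ι : Type} (T : L2 d →L[ℂ] L2 d) (ψ : ι → L2 d) : Prop :=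
  Orthonormal ℂ ψ ∧
    (∀ n, ∃ μ : ℂ, Module.End.HasEigenvector (T : Module.End ℂ (L2 d)) μ (ψ n)) ∧
    ∀ (μ : ℂ) (v : L2 d), Module.End.HasEigenvector (T : Module.End ℂ (L2 d)) μ v →
      ∃ n, inner ℂ (ψ n) v ≠ 0

/-- The quantum double orthogonality conditions with constants `c`: `ψ` is an orthonormal basis
and `∫ F(z) Q_S(ψ_n, ψ_m)(z) dz = c_n δ_{n,m}`. -/
def QuantumDoublyOrthogonal (F : 𝓢'(Phase d, ℂ)) (S : L2 d →L[ℂ] L2 d)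
    (ψ : (Fin d → ℕ) → L2 d) (c : (Fin d → ℕ) → ℂ) : Prop :=
  IsONB ψ ∧ ∀ n m, distIntegral F (polarizedCohen S (ψ n) (ψ m)) = if n = m then c n else 0

end QHA

end

/-! Since `Q_S(f, g)(z) = ⟨α_z(S) f, g⟩`, the integral of `F` against `Q_S(ψ_n, ψ_m)` is the matrix
entry `⟨(F ⋆ S) ψ_n, ψ_m⟩` (`distIntegral_polarizedCohen`). Double orthogonality thus says that the
matrix of `F ⋆ S` in the basis `ψ` is diagonal, which for an orthonormal basis means that each `ψ_n`
is an eigenvector.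

The analytic work is to show that a bounded `F ⋆ S` exists, given only convergence of the iterated
integrals. The closed graph theorem, applied to one integral at a time, makes the form continuous in
each variable separately (`exists_clm_eq_iterated_integral`); Riesz representation and another
closed graph argument then give the operator (`exists_clm_inner_eq`).

For compact normal `T`, the orthogonal complement of a system of eigenvectors reduces `T`. If it is
nonzero it contains an eigenvector of `T` (`exists_hasEigenvector_mem`), so a full system is total.
-/

namespace QHA

/-! ### Weak integrals of families of functionals -/

section WeakIntegral

variable {E : Type*} [NormedAddCommGroup E]

/-- A family of bounded functionals that is pointwise integrable has a bounded weak integral. -/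
theorem exists_clm_eq_integral [NormedSpace ℂ E] [CompleteSpace E] {Y : Type*}
    [MeasurableSpace Y] {μ : Measure Y} (K : Y → E →L[ℂ] ℂ)
    (hK : ∀ f, Integrable (fun y => K y f) μ) :
    ∃ l : E →L[ℂ] ℂ, ∀ f, l f = ∫ y, K y f ∂μ := by
  -- Once `f ↦ (y ↦ K y f)` is continuous into `L¹` by the closed graph theorem, integration is a
  -- bounded functional of `f`.
  let T : E →ₗ[ℂ] Lp ℂ 1 μ :=
    { toFun := fun f => (hK f).toL1 _
      map_add' := fun f g => by
        rw [← Integrable.toL1_add]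
        congr 1
        funext y
        simp
      map_smul' := fun c f => by
        rw [RingHom.id_apply, ← Integrable.toL1_smul]
        congr 1
        funext y
        simp }
  have hT : Continuous T := by
    refine T.continuous_of_seq_closed_graph fun u x g hu hg => ?_
    -- The `L¹` limit is an a.e. limit along a subsequence, while `K y (u n) → K y x` for every `y`;
    -- the two limits must agree.
    obtain ⟨ns, hns, hlim⟩ := (tendstoInMeasure_of_tendsto_Lp hg).exists_seq_tendsto_ae
    apply Lp.ext
    have hu' : ∀ᵐ y ∂μ, ∀ n, (T (u n) : Y → ℂ) y = K y (u n) :=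
      ae_all_iff.2 fun n => (hK (u n)).coeFn_toL1
    filter_upwards [hlim, hu', (hK x).coeFn_toL1] with y h1 h2 h3
    have h4 : Tendsto (fun i => K y (u (ns i))) atTop (𝓝 (K y x)) :=
      ((K y).continuous.tendsto x).comp (hu.comp hns.tendsto_atTop)
    refine (tendsto_nhds_unique h1 ?_).trans h3.symm
    simpa only [Function.comp_apply, h2] using h4
  exact ⟨⟨{
      toFun := fun f => ∫ y, K y f ∂μ
      map_add' := fun f g => by simpa using integral_add (hK f) (hK g)
      map_smul' := fun c f => by simp [integral_const_mul] },
    (continuous_integral.comp hT).congr fun f => L1.integral_of_fun_eq_integral (hK f)⟩,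
    fun f => rfl⟩

/-- The iterated weak integral, weighted by `V`, of the transform with kernel `w` of a pointwise
integrable family of bounded functionals is bounded. -/
theorem exists_clm_eq_iterated_integral [NormedSpace ℂ E] [CompleteSpace E] {X Y Z : Type*}
    [MeasurableSpace X] [MeasurableSpace Y] [MeasurableSpace Z]
    {μ : Measure X} {ν : Measure Y} {ρ : Measure Z}
    (h : Z → E →L[ℂ] ℂ) (V : X → Y → ℂ) (w : X → Y → Z → ℂ)
    (h1 : ∀ f x y, Integrable (fun t => h t f * w x y t) ρ)
    (h2 : ∀ f x, Integrable (fun y => V x y * ∫ t, h t f * w x y t ∂ρ) ν)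
    (h3 : ∀ f, Integrable (fun x => ∫ y, V x y * ∫ t, h t f * w x y t ∂ρ ∂ν) μ) :
    ∃ l : E →L[ℂ] ℂ, ∀ f, l f = ∫ x, ∫ y, V x y * ∫ t, h t f * w x y t ∂ρ ∂ν ∂μ := by
  have a1 : ∀ x y, ∃ l : E →L[ℂ] ℂ, ∀ f, l f = ∫ t, h t f * w x y t ∂ρ := fun x y => by
    -- Absorbing the scalar weight into the functional lets the integrals be peeled off from the
    -- inside, each yielding a new family of bounded functionals.
    obtain ⟨l, hl⟩ := exists_clm_eq_integral (μ := ρ) (fun t => w x y t • h t) fun f => by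
      simpa [mul_comm] using h1 f x y
    exact ⟨l, fun f => by simp [hl, mul_comm]⟩
  choose l1 hl1 using a1
  simp only [← hl1] at h2 h3 ⊢
  have a2 : ∀ x, ∃ l : E →L[ℂ] ℂ, ∀ f, l f = ∫ y, V x y * l1 x y f ∂ν := fun x =>
    exists_clm_eq_integral (fun y => V x y • l1 x y) (h2 · x)
  choose l2 hl2 using a2
  simp only [← hl2] at h3 ⊢
  exact exists_clm_eq_integral l2 h3

/-- A separately continuous sesquilinear form on a Hilbert space is given by a bounded operator. -/
theorem exists_clm_inner_eq [InnerProductSpace ℂ E] [CompleteSpace E] (B : E → E → ℂ)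
    (h1 : ∀ g, ∃ l : E →L[ℂ] ℂ, ∀ f, l f = B f g)
    (h2 : ∀ f, ∃ l : E →L[ℂ] ℂ, ∀ g, l g = conj (B f g)) :
    ∃ T : E →L[ℂ] E, ∀ f g, inner ℂ g (T f) = B f g := by
  choose l1 hl1 using h1
  choose l2 hl2 using h2
  let τ : E → E := fun f => (InnerProductSpace.toDual ℂ E).symm (l2 f)
  have hτ : ∀ f g, inner ℂ g (τ f) = B f g := fun f g => by
    rw [← inner_conj_symm, InnerProductSpace.toDual_symm_apply, hl2, Complex.conj_conj]
  let T : E →ₗ[ℂ] E :=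
    { toFun := τ
      map_add' := fun f f' => ext_inner_left ℂ fun g => by
        rw [inner_add_right, hτ, hτ, hτ, ← hl1, ← hl1, ← hl1, map_add]
      map_smul' := fun c f => ext_inner_left ℂ fun g => by
        rw [RingHom.id_apply, inner_smul_right, hτ, hτ, ← hl1, ← hl1, map_smul, smul_eq_mul] }
  -- As in Hellinger–Toeplitz: continuity of the form in `f` for each fixed `g` identifies the limit
  -- of `T (u n)` weakly, so the graph is closed.
  refine ⟨⟨T, T.continuous_of_seq_closed_graph fun u x y hu hy => ?_⟩, hτ⟩
  refine ext_inner_left ℂ fun g => ?_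
  have a1 : Tendsto (fun n => inner ℂ g (T (u n))) atTop (𝓝 (inner ℂ g y)) :=
    tendsto_const_nhds.inner hy
  have a2 : Tendsto (fun n => l1 g (u n)) atTop (𝓝 (l1 g x)) :=
    ((l1 g).continuous.tendsto x).comp hu
  have a3 : (fun n => inner ℂ g (T (u n))) = fun n => l1 g (u n) := by
    funext n
    rw [hl1]
    exact hτ _ _
  rw [a3] at a1
  refine (tendsto_nhds_unique a1 a2).trans ?_
  rw [hl1]
  exact (hτ _ _).symm

end WeakIntegral

/-! ### Compact normal operators -/

section CompactNormal

open ContinuousLinearMap Module.End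

variable {E : Type*} [NormedAddCommGroup E] [InnerProductSpace ℂ E] [CompleteSpace E]

/-- A compact normal operator has an eigenvector in every nonzero closed reducing subspace. -/
theorem exists_hasEigenvector_mem {T : E →L[ℂ] E} (hc : IsCompactOperator T)
    (hn : IsStarNormal T) (W : Submodule ℂ E) [CompleteSpace W] (hW : W ≠ ⊥)
    (h1 : ∀ w ∈ W, T w ∈ W) (h2 : ∀ w ∈ W, adjoint T w ∈ W) :
    ∃ (μ : ℂ) (v : E), v ∈ W ∧ HasEigenvector (T : Module.End ℂ E) μ v := by
  have h3 : ∀ w ∈ W, (adjoint T ∘L T) w ∈ W := fun w hw => h2 _ (h1 w hw)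
  -- `T* T` is self-adjoint even though `T` is not, so the spectral theorem for compact self-adjoint
  -- operators applies on `W`.
  let A : W →L[ℂ] W := (adjoint T ∘L T).restrict h3
  have hA : ∀ w : W, ((A w : W) : E) = adjoint T (T w) := fun w => rfl
  have hAc : IsCompactOperator A := IsCompactOperator.restrict' (hc.clm_comp (adjoint T)) h3
  have hAs : A.IsSymmetric := fun x y => by
    change inner ℂ ((A x : W) : E) (y : E) = inner ℂ (x : E) ((A y : W) : E)
    rw [hA, hA, adjoint_inner_left, adjoint_inner_right]
  have hex : ∃ l, eigenspace (A : Module.End ℂ W) l ≠ ⊥ := by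
    by_contra! hcon
    have h := ContinuousLinearMap.orthogonalComplement_iSup_eigenspaces_eq_bot hAc hAs
    simp only [hcon, iSup_bot, Submodule.bot_orthogonal_eq_top] at h
    have : Nontrivial W := (Submodule.nontrivial_iff_ne_bot).2 hW
    exact top_ne_bot h
  obtain ⟨l, hl⟩ := hex
  -- The eigenspace for `l = 0` may be infinite-dimensional, but there `‖T w‖² = ⟨T* T w, w⟩ = 0`,
  -- so `w` itself is an eigenvector of `T`.
  by_cases hl0 : l = 0
  · obtain ⟨w, hw, hw0⟩ := Submodule.exists_mem_ne_zero_of_ne_bot hl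
    have hAw : adjoint T (T w) = 0 := by
      rw [← hA]
      have := mem_eigenspace_iff.1 hw
      rw [hl0, zero_smul] at this
      exact congrArg Subtype.val this
    refine ⟨0, w, w.2, mem_eigenspace_iff.2 ?_, fun h => hw0 (Subtype.ext h)⟩
    have : inner ℂ (T w) (T w) = 0 := by
      rw [← adjoint_inner_right, hAw, inner_zero_right]
    simpa using inner_self_eq_zero.1 this
  -- For `l ≠ 0` the eigenspace is finite-dimensional and, by normality, invariant under `T`, which
  -- therefore has an eigenvector in it over `ℂ`.
  · have hfin := ContinuousLinearMap.finite_dimensional_eigenspace hAc l hl0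
    let TW : Module.End ℂ W := (T : Module.End ℂ E).restrict h1
    have hTW : ∀ w : W, ((TW w : W) : E) = T w := fun w => rfl
    have hcomm : ∀ x, adjoint T (T x) = T (adjoint T x) := fun x =>
      congrArg (fun B : E →L[ℂ] E => B x) hn.star_comm_self.eq
    have hmap : ∀ w ∈ eigenspace (A : Module.End ℂ W) l,
        TW w ∈ eigenspace (A : Module.End ℂ W) l := fun w hw => by
      have hw' := congrArg Subtype.val (mem_eigenspace_iff.1 hw)
      refine mem_eigenspace_iff.2 (Subtype.ext ?_)
      change adjoint T (T (T w)) = l • T w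
      change adjoint T (T w) = l • (w : E) at hw'
      rw [hcomm, hw', map_smul]
    have : Nontrivial (eigenspace (A : Module.End ℂ W) l) :=
      (Submodule.nontrivial_iff_ne_bot).2 hl
    obtain ⟨μ, hμ⟩ := Module.End.exists_eigenvalue (TW.restrict hmap)
    obtain ⟨v, hv⟩ := hμ.exists_hasEigenvector
    refine ⟨μ, v, (v : W).2, mem_eigenspace_iff.2 ?_,
      fun h => hv.2 (Subtype.ext (Subtype.ext h))⟩
    exact congrArg (fun x : eigenspace (A : Module.End ℂ W) l => ((x : W) : E)) hv.apply_eq_smul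

/-- For a normal operator, an eigenvector is an eigenvector of the adjoint. -/
theorem adjoint_apply_of_apply_eq_smul {T : E →L[ℂ] E} (hn : IsStarNormal T) {μ : ℂ} {v : E}
    (h : T v = μ • v) : adjoint T v = conj μ • v := by
  -- A normal operator and its adjoint have the same kernel; this is applied to `T - μ`.
  have hn' : IsStarNormal (T - algebraMap ℂ (E →L[ℂ] E) μ) := by
    refine ⟨?_⟩
    rw [star_sub, ← algebraMap_star_comm]
    exact ((hn.star_comm_self.sub_left (Algebra.commutes _ _)).sub_right
      (Algebra.commutes _ _).symm)
  have h0 : (T - algebraMap ℂ (E →L[ℂ] E) μ) v = 0 := by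
    simp [Algebra.algebraMap_eq_smul_one, h]
  have := (ContinuousLinearMap.IsStarNormal.adjoint_apply_eq_zero_iff hn' v).2 h0
  rw [← star_eq_adjoint, star_sub, ← algebraMap_star_comm] at this
  simpa [Algebra.algebraMap_eq_smul_one, sub_eq_zero, star_eq_adjoint] using this

/-- An orthonormal system of eigenvectors of a compact normal operator is total if no eigenvector
is orthogonal to it. -/
theorem span_closure_eq_top_of_full {ι : Type*} {T : E →L[ℂ] E} (hc : IsCompactOperator T)
    (hn : IsStarNormal T) (ψ : ι → E)
    (h1 : ∀ n, ∃ μ : ℂ, HasEigenvector (T : Module.End ℂ E) μ (ψ n))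
    (h2 : ∀ (μ : ℂ) (v : E), HasEigenvector (T : Module.End ℂ E) μ v →
      ∃ n, inner ℂ (ψ n) v ≠ 0) :
    (Submodule.span ℂ (Set.range ψ)).topologicalClosure = ⊤ := by
  rw [Submodule.topologicalClosure_eq_top_iff]
  by_contra hW
  have hmem : ∀ v, v ∈ (Submodule.span ℂ (Set.range ψ))ᗮ ↔ ∀ n, inner ℂ (ψ n) v = 0 := fun v => by
    rw [Submodule.mem_orthogonal]
    refine ⟨fun h n => h _ (Submodule.subset_span ⟨n, rfl⟩), fun h u hu => ?_⟩
    induction hu using Submodule.span_induction with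
    | mem x hx => obtain ⟨n, rfl⟩ := hx; exact h n
    | zero => simp
    | add x y _ _ hx hy => rw [inner_add_left, hx, hy, add_zero]
    | smul a x _ hx => rw [inner_smul_left, hx, mul_zero]
  -- The complement is invariant under `T` because each `ψ n` is also an eigenvector of `T*`, and
  -- under `T*` because each is an eigenvector of `T`.
  obtain ⟨μ, v, hv, hev⟩ := exists_hasEigenvector_mem hc hn _ hW
    (fun w hw => (hmem _).2 fun n => by
      obtain ⟨μ, hμ⟩ := h1 n
      rw [← adjoint_inner_left, adjoint_apply_of_apply_eq_smul hn hμ.apply_eq_smul,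
        inner_smul_left, (hmem _).1 hw, mul_zero])
    (fun w hw => (hmem _).2 fun n => by
      obtain ⟨μ, hμ⟩ := h1 n
      have : T (ψ n) = μ • ψ n := hμ.apply_eq_smul
      rw [adjoint_inner_right, this, inner_smul_left, (hmem _).1 hw, mul_zero])
  obtain ⟨n, hn0⟩ := h2 μ v hev
  exact hn0 ((hmem v).1 hv n)

end CompactNormal

/-! ### Measurability of matrix coefficients of shifted operators -/

variable {d : ℕ}

theorem continuous_translation (u : L2 d) : Continuous fun x : Pos d => translation x u :=
  Continuous.compMeasurePreservingLp (f := fun _ : Pos d => u)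
    (g := fun x : Pos d => (⟨fun t => t - x, by fun_prop⟩ : C(Pos d, Pos d)))
    continuous_const (ContinuousMap.continuous_of_continuous_uncurry _
      (continuous_snd.sub continuous_fst))
    (fun x => measurePreserving_sub_right volume x) (by simp)

/-- Dominated convergence: the character has modulus one, so `|⟨g(t), h(t)⟩|` is an integrable
bound. -/
theorem continuous_inner_modulation (g h : L2 d) :
    Continuous fun ω : Pos d => inner ℂ g (modulation ω h) := by
  have h1 : ∀ ω : Pos d, inner ℂ g (modulation ω h) =
      ∫ t, char (inner ℝ ω t) * inner ℂ (g t) (h t) := fun ω => by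
    rw [L2.inner_def]
    refine integral_congr_ae ?_
    filter_upwards [(memLp_modulation ω h).coeFn_toLp] with t ht
    rw [← inner_smul_right]
    exact congrArg _ ht
  simp only [h1]
  have hint := L2.integrable_inner (𝕜 := ℂ) g h
  have hch : ∀ ω : Pos d, Continuous fun t : Pos d => char (inner ℝ ω t) := fun ω =>
    continuous_char.comp (by fun_prop)
  refine continuous_of_dominated (bound := fun t => ‖inner ℂ (g t) (h t)‖)
    (fun ω => (hch ω).aestronglyMeasurable.mul hint.aestronglyMeasurable)
    (fun ω => Eventually.of_forall fun t => by rw [norm_mul, norm_char, one_mul]) hint.norm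
    (Eventually.of_forall fun t => ?_)
  exact (continuous_char.comp (by fun_prop)).mul continuous_const

theorem continuous_inner_tfShift (g u : L2 d) :
    Continuous fun z : Phase d => inner ℂ g (tfShift z u) := by
  rw [continuous_iff_continuousAt]
  intro z₀
  have h1 : Tendsto (fun z : Phase d => inner ℂ g (modulation z.2 (translation z₀.1 u))) (𝓝 z₀)
      (𝓝 (inner ℂ g (modulation z₀.2 (translation z₀.1 u)))) :=
    (((continuous_inner_modulation g (translation z₀.1 u)).comp continuous_snd).tendsto z₀)
  -- Modulations are isometries, so the error from moving the translation is small uniformly in the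
  -- frequency.
  have h2 : Tendsto (fun z : Phase d =>
      inner ℂ g (modulation z.2 (translation z.1 u - translation z₀.1 u))) (𝓝 z₀) (𝓝 0) := by
    have h3 : Tendsto (fun z : Phase d => ‖g‖ * ‖translation z.1 u - translation z₀.1 u‖) (𝓝 z₀)
        (𝓝 0) := by
      have : Continuous fun z : Phase d => ‖g‖ * ‖translation z.1 u - translation z₀.1 u‖ :=
        continuous_const.mul
          (((continuous_translation u).comp continuous_fst).sub continuous_const).norm
      simpa using this.tendsto z₀
    refine squeeze_zero_norm (fun z => ?_) h3
    exact (norm_inner_le_norm _ _).trans_eq (by rw [LinearIsometry.norm_map])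
  have h4 := h1.add h2
  rw [add_zero] at h4
  refine h4.congr fun z => ?_
  rw [← inner_add_right, ← map_add, add_sub_cancel]
  rfl

/-- The singular value expansion exhibits the coefficient as a pointwise limit of finite sums of
continuous functions of `z`. -/
theorem aestronglyMeasurable_inner_opShift {S : L2 d →L[ℂ] L2 d} (hS : IsTraceClass S)
    (f g : L2 d) :
    AEStronglyMeasurable (fun z : Phase d => inner ℂ g (opShift z S f)) volume := by
  obtain ⟨I, σ, u, v, -, -, -, -, hsum⟩ := hS
  refine aestronglyMeasurable_of_tendsto_ae (u := (atTop : Filter (Finset I)))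
    (f := fun s z => ∑ k ∈ s, (σ k : ℂ) * (inner ℂ (tfShift z (v k)) f *
      inner ℂ g (tfShift z (u k))))
    (fun s => ?_) (Eventually.of_forall fun z => ?_)
  · refine Continuous.aestronglyMeasurable (continuous_finsetSum _ fun k _ =>
      continuous_const.mul (Continuous.mul ?_ (continuous_inner_tfShift _ _)))
    simp only [← inner_conj_symm _ f]
    exact Complex.continuous_conj.comp (continuous_inner_tfShift _ _)
  · let L : (L2 d →L[ℂ] L2 d) →L[ℂ] ℂ := (innerSL ℂ g ∘L tfShift z) ∘L
      ContinuousLinearMap.apply ℂ (L2 d) (ContinuousLinearMap.adjoint (tfShift z) f)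
    have := L.hasSum hsum
    refine this.congr fun s => Finset.sum_congr rfl fun k _ => ?_
    simp [L, InnerProductSpace.rankOne_apply,
      ContinuousLinearMap.adjoint_inner_right]

theorem norm_inner_opShift_le (S : L2 d →L[ℂ] L2 d) (f g : L2 d) (z : Phase d) :
    ‖inner ℂ g (opShift z S f)‖ ≤ ‖g‖ * (‖S‖ * ‖f‖) := by
  have h1 : ‖(tfShift z : L2 d →L[ℂ] L2 d)‖ ≤ 1 := LinearIsometry.norm_toContinuousLinearMap_le _
  refine (norm_inner_le_norm _ _).trans (mul_le_mul_of_nonneg_left ?_ (norm_nonneg g))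
  change ‖tfShift z (S (ContinuousLinearMap.adjoint (tfShift z) f))‖ ≤ _
  have h2 : ‖ContinuousLinearMap.adjoint (tfShift z) f‖ ≤ ‖f‖ :=
    (ContinuousLinearMap.le_of_opNorm_le _
      ((LinearIsometryEquiv.norm_map ContinuousLinearMap.adjoint _).trans_le h1) f).trans_eq
      (one_mul _)
  calc _ ≤ 1 * ‖S (ContinuousLinearMap.adjoint (tfShift z) f)‖ :=
        ContinuousLinearMap.le_of_opNorm_le _ h1 _
    _ ≤ ‖S‖ * ‖f‖ := by
      rw [one_mul]
      exact (S.le_opNorm _).trans (by gcongr)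

/-! ### Existence of the mixed-state localization operator -/

theorem isAddHaarMeasure_volume_phase : (volume : Measure (Phase d)).IsAddHaarMeasure :=
  Measure.prod.instIsAddHaarMeasure volume volume

theorem integrable_conj_comp {X : Type*} [MeasurableSpace X] {μ : Measure X} {f : X → ℂ}
    (hf : Integrable f μ) : Integrable (fun x => conj (f x)) μ :=
  (Complex.conjCLE : ℂ →L[ℝ] ℂ).integrable_comp hf

theorem integrable_inner_opShift_mul_window {S : L2 d →L[ℂ] L2 d} (hS : IsTraceClass S)
    (f g : L2 d) (y ζ : Phase d) :
    Integrable (fun t : Phase d => inner ℂ g (opShift t S f) *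
      (gaussian d (t - y) * conj (char (-phaseInner ζ t)))) := by
  have := isAddHaarMeasure_volume_phase (d := d)
  have hφ : Integrable fun t : Phase d => gaussian d (t - y) :=
    (gaussian d).integrable.comp_sub_right y
  have hch : Continuous fun t : Phase d => conj (char (-phaseInner ζ t)) :=
    Complex.continuous_conj.comp (hasTemperateGrowth_char_phaseInner ζ).1.continuous
  refine Integrable.bdd_mul (c := ‖g‖ * (‖S‖ * ‖f‖)) ?_
    (aestronglyMeasurable_inner_opShift hS f g)
    (Eventually.of_forall fun z => norm_inner_opShift_le S f g z)
  exact hφ.mul_bdd (c := 1) hch.aestronglyMeasurable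
    (Eventually.of_forall fun t => by rw [RCLike.norm_conj, norm_char])

/-- The two conjugations cancel, which displays the integrand as linear in `H`, in the shape of
`exists_clm_eq_iterated_integral`. -/
theorem pairingIntegrand_eq (F : 𝓢'(Phase d, ℂ)) (H : Phase d → ℂ) (y ζ : Phase d) :
    pairingIntegrand F H y ζ = distSTFT (gaussian d) F y ζ *
      ∫ t, H t * (gaussian d (t - y) * conj (char (-phaseInner ζ t))) := by
  rw [pairingIntegrand, funSTFT, ← integral_conj]
  simp only [map_mul, Complex.conj_conj, mul_assoc]

/-- `mixedLocOp` defaults to `0` when no representing operator exists, so the point is to rule out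
that case. -/
theorem inner_mixedLocOp {S : L2 d →L[ℂ] L2 d} (hS : IsTraceClass S)
    {F : 𝓢'(Phase d, ℂ)} (hFS : WeaklyConvergent F S) (f g : L2 d) :
    inner ℂ g (mixedLocOp F S f) = distIntegral F fun z => inner ℂ g (opShift z S f) := by
  have hex : ∃ T : L2 d →L[ℂ] L2 d, ∀ f g : L2 d,
      inner ℂ g (T f) = distIntegral F fun z => inner ℂ g (opShift z S f) := by
    simp only [WeaklyConvergent, DistIntegrable, funext (pairingIntegrand_eq F _ _)] at hFS
    simp only [distIntegral, pairingIntegrand_eq]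
    refine exists_clm_inner_eq _ (fun g => ?_) (fun f => ?_)
    · exact exists_clm_eq_iterated_integral (fun z => innerSL ℂ g ∘L opShift z S) _ _
        (fun f => integrable_inner_opShift_mul_window hS f g)
        (fun f => (hFS f g).1) (fun f => (hFS f g).2)
    -- The form is conjugate-linear in `g`; conjugating coefficient, weight and kernel together
    -- gives a linear problem whose integrals are the conjugates of the given ones.
    · have hconj : ∀ (g : L2 d) (y ζ : Phase d),
          ∫ t, innerSL ℂ (opShift t S f) g *
            conj (gaussian d (t - y) * conj (char (-phaseInner ζ t))) =
          conj (∫ t, inner ℂ g (opShift t S f) *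
            (gaussian d (t - y) * conj (char (-phaseInner ζ t)))) := fun g y ζ => by
        rw [← integral_conj]
        simp
      obtain ⟨l, hl⟩ := exists_clm_eq_iterated_integral (μ := volume) (ν := volume) (ρ := volume)
        (fun z => innerSL ℂ (opShift z S f))
        (fun y ζ => conj (distSTFT (gaussian d) F y ζ))
        (fun y ζ t => conj (gaussian d (t - y) * conj (char (-phaseInner ζ t))))
        (fun g y ζ => by
          have := integrable_conj_comp (integrable_inner_opShift_mul_window hS f g y ζ)
          simpa using this)
        (fun g y => by
          simp only [hconj, ← map_mul]
          exact integrable_conj_comp ((hFS f g).1 y))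
        (fun g => by
          simp only [hconj, ← map_mul, integral_conj]
          exact integrable_conj_comp (hFS f g).2)
      refine ⟨l, fun g => ?_⟩
      rw [hl]
      simp only [hconj, ← map_mul, integral_conj]
  rw [mixedLocOp, dif_pos hex]
  exact hex.choose_spec f g

/-! ### Quantum double orthogonality -/

theorem IsONB.eq_zero {ι : Type} {ψ : ι → L2 d} (hψ : IsONB ψ) {v : L2 d}
    (h : ∀ n, inner ℂ (ψ n) v = 0) : v = 0 := by
  have h1 := (Submodule.topologicalClosure_eq_top_iff).1 hψ.2
  rw [← Submodule.mem_bot ℂ, ← h1, Submodule.mem_orthogonal]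
  intro u hu
  induction hu using Submodule.span_induction with
  | mem x hx => obtain ⟨n, rfl⟩ := hx; exact h n
  | zero => simp
  | add x y _ _ hx hy => rw [inner_add_left, hx, hy, add_zero]
  | smul a x _ hx => rw [inner_smul_left, hx, mul_zero]

theorem distIntegral_polarizedCohen {S : L2 d →L[ℂ] L2 d} (hS : IsTraceClass S)
    {F : 𝓢'(Phase d, ℂ)} (hFS : WeaklyConvergent F S) (f g : L2 d) :
    distIntegral F (polarizedCohen S f g) = inner ℂ g (mixedLocOp F S f) := by
  rw [inner_mixedLocOp hS hFS, funext (polarizedCohen_apply S f g)]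

theorem QuantumDoublyOrthogonal.hasEigenvector {S : L2 d →L[ℂ] L2 d} (hS : IsTraceClass S)
    {F : 𝓢'(Phase d, ℂ)} (hFS : WeaklyConvergent F S) {ψ : (Fin d → ℕ) → L2 d}
    {c : (Fin d → ℕ) → ℂ} (h : QuantumDoublyOrthogonal F S ψ c) (n : Fin d → ℕ) :
    Module.End.HasEigenvector (mixedLocOp F S : Module.End ℂ (L2 d)) (c n) (ψ n) := by
  -- The vector `(F ⋆ S) ψ_n - c_n ψ_n` is orthogonal to every `ψ_m`, hence zero by totality.
  refine ⟨Module.End.mem_eigenspace_iff.2 (sub_eq_zero.1 (h.1.eq_zero fun m => ?_)),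
    h.1.1.ne_zero n⟩
  rw [inner_sub_right, inner_smul_right, orthonormal_iff_ite.1 h.1.1]
  change inner ℂ (ψ m) (mixedLocOp F S (ψ n)) - _ = 0
  rw [← distIntegral_polarizedCohen hS hFS, h.2]
  by_cases hnm : n = m <;> simp [hnm, eq_comm]

theorem isEigenbasis_mixedLocOp_iff {S : L2 d →L[ℂ] L2 d} (hS : IsTraceClass S)
    {F : 𝓢'(Phase d, ℂ)} (hFS : WeaklyConvergent F S) (ψ : (Fin d → ℕ) → L2 d) :
    IsEigenbasis (mixedLocOp F S) ψ ↔ ∃ c, QuantumDoublyOrthogonal F S ψ c := by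
  refine ⟨fun h => ?_, fun ⟨c, h⟩ => ⟨h.1, fun n => ⟨c n, h.hasEigenvector hS hFS n⟩⟩⟩
  choose c hc using h.2
  refine ⟨c, h.1, fun n m => ?_⟩
  have hcn : mixedLocOp F S (ψ n) = c n • ψ n := (hc n).apply_eq_smul
  rw [distIntegral_polarizedCohen hS hFS, hcn, inner_smul_right, orthonormal_iff_ite.1 h.1.1]
  by_cases hnm : n = m <;> simp [hnm, eq_comm]

/-- Compactness and normality serve only to make a full system total; conversely, no nonzero vector
is orthogonal to an orthonormal basis. -/
theorem isFullEigensystem_iff_isEigenbasis {ι : Type} {T : L2 d →L[ℂ] L2 d}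
    (hc : IsCompactOperator T) (hn : IsStarNormal T) (ψ : ι → L2 d) :
    IsFullEigensystem T ψ ↔ IsEigenbasis T ψ := by
  refine ⟨fun h => ⟨⟨h.1, span_closure_eq_top_of_full hc hn ψ h.2.1 h.2.2⟩, h.2.1⟩,
    fun h => ⟨h.1.1, h.2, fun μ v hv => ?_⟩⟩
  by_contra! hcon
  exact hv.2 (h.1.eq_zero hcon)

end QHA

theorem mainTheorem4 (d : ℕ) (S : QHA.L2 d →L[ℂ] QHA.L2 d) (hS : QHA.IsTraceClass S)
    (F : 𝓢'(QHA.Phase d, ℂ)) (hF : F ∈ QHA.fernandezGalbis d)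
    (hFS : QHA.WeaklyConvergent F S) (ψ : (Fin d → ℕ) → QHA.L2 d) :
    (QHA.IsEigenbasis (QHA.mixedLocOp F S) ψ ↔ ∃ c, QHA.QuantumDoublyOrthogonal F S ψ c) ∧
    (∀ c, QHA.QuantumDoublyOrthogonal F S ψ c → ∀ n,
      Module.End.HasEigenvector (QHA.mixedLocOp F S : Module.End ℂ (QHA.L2 d)) (c n) (ψ n)) ∧
    (IsCompactOperator (QHA.mixedLocOp F S) → IsStarNormal (QHA.mixedLocOp F S) →
      (QHA.IsFullEigensystem (QHA.mixedLocOp F S) ψ ↔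
        ∃ c, QHA.QuantumDoublyOrthogonal F S ψ c)) :=
  ⟨QHA.isEigenbasis_mixedLocOp_iff hS hFS ψ, fun _ h => h.hasEigenvector hS hFS,
    fun hc hn => (QHA.isFullEigensystem_iff_isEigenbasis hc hn ψ).trans
      (QHA.isEigenbasis_mixedLocOp_iff hS hFS ψ)⟩
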